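/- Let $A\in\mathbb{Z}^{m\times n}$ be an integer matrix and let $\mathcal{L}=\{\mathbf u\in\mathbb{Z}^n : A\mathbf u=\mathbf 0\}$. A finite set $M\subset\mathcal{L}$ is a *Markov basis* of $A$ if, for all $\mathbf w,\mathbf u\in\mathbb{N}^n$ with $\mathbf w-\mathbf u\in\mathcal{L}$, one can pass from $\mathbf w$ to $\mathbf u$ in finitely many steps, each adding or subtracting an element of $M$ (repetitions allowed), with all intermediate vectors in $\mathbb{N}^n$. A Markov basis is *minimal* if no proper subset of it is a Markov basis. The *universal Markov basis* of $A$ is the union of all minimal Markov bases of $A$ whose cardinality is smallest among all minimal Markov bases of $A$. For $\mathbf u\in\mathbb{Z}^n$ let $\mathbf u^+,\mathbf u^-\in\mathbb{N}^n$ be its positive and negative parts, given coordinatewise by $u_i^+=\max(u_i,0)$ and $u_i^-=\max(-u_i,0)$. The *Graver basis* of $A$ is the set of all nonzero $\mathbf u\in\mathcal{L}$ that cannot be written as $\mathbf u=\mathbf v+\mathbf w$ with nonzero $\mathbf v,\mathbf w\in\mathcal{L}$, $\mathbf u^+=\mathbf v^++\mathbf w^+$ and $\mathbf u^-=\mathbf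 v^-+\mathbf w^-$. Let $\mathcal{L}_{pure}$ be the sublattice of $\mathcal{L}$ generated by $\mathcal{L}\cap\mathbb{N}^n$. **Theorem.** The universal Markov basis of $A$ is a subset of the Graver basis of $A$ if and only if either $\mathcal{L}\cap\mathbb{N}^n=\{\mathbf 0\}$, or $\mathcal{L}=\mathcal{L}_{pure}$ and $\operatorname{rank}\mathcal{L}=1$. -/

import Mathlib

/-- The lattice of integer vectors `u` with `A u = 0`. -/
def kerLattice {m n : ℕ} (A : Matrix (Fin m) (Fin n) ℤ) : Submodule ℤ (Fin n → ℤ) :=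
  LinearMap.ker A.mulVecLin

/-- A lattice in `ℤⁿ` is positive if its only vector with all coordinates nonnegative is `0`. -/
def IsPositiveLattice {n : ℕ} (L : Submodule ℤ (Fin n → ℤ)) : Prop :=
  {u : Fin n → ℤ | u ∈ L ∧ 0 ≤ u} = {0}

/-- The sublattice of `L` generated by the vectors of `L` with nonnegative coordinates. -/
def pureSublattice {n : ℕ} (L : Submodule ℤ (Fin n → ℤ)) : Submodule ℤ (Fin n → ℤ) :=
  Submodule.span ℤ {u : Fin n → ℤ | u ∈ L ∧ 0 ≤ u}

/-- One move: `b` is a nonnegative vector obtained from `a` by adding or subtracting an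
element of `M`. -/
def MarkovStep {n : ℕ} (M : Finset (Fin n → ℤ)) (a b : Fin n → ℤ) : Prop :=
  0 ≤ b ∧ ∃ v ∈ M, b = a + v ∨ b = a - v

/-- A Markov basis of `A`: a finite set of vectors in the kernel lattice such that any two
nonnegative integer vectors differing by an element of that lattice are joined by finitely many
moves, all the intermediate vectors being nonnegative. -/
def IsMarkovBasis {m n : ℕ} (A : Matrix (Fin m) (Fin n) ℤ) (M : Finset (Fin n → ℤ)) : Prop :=
  (∀ v ∈ M, v ∈ kerLattice A) ∧
    ∀ w u : Fin n → ℤ, 0 ≤ w → 0 ≤ u → w - u ∈ kerLattice A →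
      Relation.ReflTransGen (MarkovStep M) w u

/-- A Markov basis is minimal if no proper subset of it is a Markov basis. -/
def IsMinimalMarkovBasis {m n : ℕ} (A : Matrix (Fin m) (Fin n) ℤ)
    (M : Finset (Fin n → ℤ)) : Prop :=
  IsMarkovBasis A M ∧ ∀ M' : Finset (Fin n → ℤ), M' ⊂ M → ¬ IsMarkovBasis A M'

/-- The union of all minimal Markov bases of `A` of minimal cardinality. Since moves may be added
or subtracted, this set is closed under negation. -/
def universalMarkovBasis {m n : ℕ} (A : Matrix (Fin m) (Fin n) ℤ) : Set (Fin n → ℤ) :=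
  {u | ∃ M : Finset (Fin n → ℤ), IsMinimalMarkovBasis A M ∧
    (∀ M' : Finset (Fin n → ℤ), IsMinimalMarkovBasis A M' → M.card ≤ M'.card) ∧ u ∈ M}

/-- `u = v + w` is a conformal decomposition: positive and negative parts add up separately. -/
def IsConformalSum {n : ℕ} (u v w : Fin n → ℤ) : Prop :=
  u = v + w ∧ u⁺ = v⁺ + w⁺ ∧ u⁻ = v⁻ + w⁻

/-- The Graver basis of `A`: the nonzero vectors of the kernel lattice that are not a conformal sum
of two nonzero vectors of that lattice. -/
def graverBasis {m n : ℕ} (A : Matrix (Fin m) (Fin n) ℤ) : Set (Fin n → ℤ) :=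
  {u | u ∈ kerLattice A ∧ u ≠ 0 ∧
    ¬ ∃ v w : Fin n → ℤ, v ∈ kerLattice A ∧ w ∈ kerLattice A ∧ v ≠ 0 ∧ w ≠ 0 ∧
      IsConformalSum u v w}

/-! Suppose the lattice contains a nonzero nonnegative vector. A path to it from the origin starts
with a move `± v = c ≥ 0`. In a Markov basis of smallest cardinality, any other move `u` may be
traded for `u + k • c`, and for large `k` the vector `c` splits off conformally. So containment in
the Graver basis forces the basis to be `{v}`, and the lattice is spanned by `c`
(`exists_nonneg_span_eq_of_universalMarkovBasis_subset`). Conversely, over such a lattice only `{c}`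
and `{-c}` can be smallest, and `± c` are Graver elements. If the lattice is positive and `u = v +
w` conformally, the paths for `v` and `w` never use `u`, so `u` is redundant
(`IsMinimalMarkovBasis.mem_graverBasis`). -/

section MarkovPaths

variable {n : ℕ} {M M' : Finset (Fin n → ℤ)} {a b : Fin n → ℤ}

theorem MarkovStep.symm (ha : 0 ≤ a) (h : MarkovStep M a b) : MarkovStep M b a := by
  obtain ⟨_, v, hv, rfl | rfl⟩ := h
  · exact ⟨ha, v, hv, Or.inr (by simp)⟩
  · exact ⟨ha, v, hv, Or.inl (by simp)⟩

theorem markovPath_nonneg (ha : 0 ≤ a) (h : Relation.ReflTransGen (MarkovStep M) a b) :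
    0 ≤ b := by
  induction h with
  | refl => exact ha
  | tail _ h _ => exact h.1

theorem markovPath_symm (ha : 0 ≤ a) (h : Relation.ReflTransGen (MarkovStep M) a b) :
    Relation.ReflTransGen (MarkovStep M) b a := by
  induction h with
  | refl => exact .refl
  | tail h₁ h₂ ih => exact .head (h₂.symm (markovPath_nonneg ha h₁)) ih

theorem markovPath_add_right {c : Fin n → ℤ} (hc : 0 ≤ c)
    (h : Relation.ReflTransGen (MarkovStep M) a b) :
    Relation.ReflTransGen (MarkovStep M) (a + c) (b + c) := by
  refine Relation.ReflTransGen.lift (· + c) ?_ _ _ h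
  rintro x y ⟨hy, v, hv, rfl | rfl⟩
  · exact ⟨add_nonneg hy hc, v, hv, Or.inl (add_right_comm x v c)⟩
  · exact ⟨add_nonneg hy hc, v, hv, Or.inr (sub_add_eq_add_sub x v c)⟩

theorem markovPath_nsmul (h : Relation.ReflTransGen (MarkovStep M) 0 b) (ha : 0 ≤ a) (k : ℕ) :
    Relation.ReflTransGen (MarkovStep M) a (a + k • b) := by
  have hb : 0 ≤ b := markovPath_nonneg le_rfl h
  induction k with
  | zero => simpa using Relation.ReflTransGen.refl
  | succ k ih =>
    refine ih.trans ?_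
    have := markovPath_add_right (add_nonneg ha (nsmul_nonneg hb k)) h
    rw [zero_add] at this
    convert this using 1
    rw [succ_nsmul]; abel

/-- Only additions need simulating, since paths between nonnegative vectors reverse. -/
theorem markovPath_of_forall_move (hM : ∀ v ∈ M, ∀ x : Fin n → ℤ, 0 ≤ x → 0 ≤ x + v →
      Relation.ReflTransGen (MarkovStep M') x (x + v))
    (ha : 0 ≤ a) (h : Relation.ReflTransGen (MarkovStep M) a b) :
    Relation.ReflTransGen (MarkovStep M') a b := by
  induction h with
  | refl => exact .refl
  | tail h₁ h₂ ih =>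
    refine ih.trans ?_
    have hx := markovPath_nonneg ha h₁
    obtain ⟨hy, v, hv, rfl | rfl⟩ := h₂
    · exact hM v hv _ hx hy
    · have := hM v hv _ hy (by simpa using hx)
      rw [sub_add_cancel] at this
      exact markovPath_symm hy this

theorem sub_mem_span_of_markovPath (h : Relation.ReflTransGen (MarkovStep M) a b) :
    b - a ∈ Submodule.span ℤ (M : Set (Fin n → ℤ)) := by
  induction h with
  | refl => simp
  | @tail x y _ h₂ ih =>
    obtain ⟨_, v, hv, rfl | rfl⟩ := h₂
    · have := add_mem ih (Submodule.subset_span (R := ℤ) (Finset.mem_coe.2 hv))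
      convert this using 1; abel
    · have := sub_mem ih (Submodule.subset_span (R := ℤ) (Finset.mem_coe.2 hv))
      convert this using 1; abel

end MarkovPaths

section MarkovBases

variable {m n : ℕ} {A : Matrix (Fin m) (Fin n) ℤ} {M : Finset (Fin n → ℤ)}

/-! ### Existence and modification of Markov bases. -/

theorem IsMarkovBasis.of_forall_move (hM : IsMarkovBasis A M) {M' : Finset (Fin n → ℤ)}
    (hM' : ∀ v ∈ M', v ∈ kerLattice A)
    (h : ∀ v ∈ M, ∀ x : Fin n → ℤ, 0 ≤ x → 0 ≤ x + v →
      Relation.ReflTransGen (MarkovStep M') x (x + v)) : IsMarkovBasis A M' :=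
  ⟨hM', fun w u hw hu hwu => markovPath_of_forall_move h hw (hM.2 w u hw hu hwu)⟩

theorem IsMarkovBasis.span_eq (hM : IsMarkovBasis A M) :
    Submodule.span ℤ (M : Set (Fin n → ℤ)) = kerLattice A := by
  refine le_antisymm (Submodule.span_le.2 fun v hv => hM.1 v hv) fun l hl => ?_
  have h := sub_mem_span_of_markovPath (hM.2 (l⁻) (l⁺) (negPart_nonneg l) (posPart_nonneg l) (by
    rw [← neg_sub, posPart_sub_negPart]; exact neg_mem hl))
  rwa [posPart_sub_negPart] at h

theorem markovPath_of_mem {v x : Fin n → ℤ} (hv : v ∈ M) (hxv : 0 ≤ x + v) :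
    Relation.ReflTransGen (MarkovStep M) x (x + v) :=
  .single ⟨hxv, v, hv, Or.inl rfl⟩

/-- Every nonzero vector of the lattice lies, in its own orthant, above one of finitely many. -/
theorem exists_finset_conformal_below (L : Submodule ℤ (Fin n → ℤ)) :
    ∃ M : Finset (Fin n → ℤ), (∀ g ∈ M, g ∈ L ∧ g ≠ 0) ∧
      ∀ l ∈ L, l ≠ 0 → ∃ g ∈ M, g⁺ ≤ l⁺ ∧ g⁻ ≤ l⁻ := by
  let f : (Fin n → ℤ) → (Fin n → ℕ) × (Fin n → ℕ) :=
    fun l => (fun i => (l i).toNat, fun i => (-l i).toNat)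
  have hf : ∀ g l, f g ≤ f l → g⁺ ≤ l⁺ ∧ g⁻ ≤ l⁻ := by
    intro g l h
    refine ⟨fun i => ?_, fun i => ?_⟩
    · have h1 : (g i).toNat ≤ (l i).toNat := h.1 i
      rw [Pi.posPart_apply, Pi.posPart_apply, posPart_def, posPart_def]
      change max (g i) 0 ≤ max (l i) 0
      omega
    · have h1 : (-g i).toNat ≤ (-l i).toNat := h.2 i
      rw [Pi.negPart_apply, Pi.negPart_apply, negPart_def, negPart_def]
      change max (-g i) 0 ≤ max (-l i) 0
      omega
  let S : Set ((Fin n → ℕ) × (Fin n → ℕ)) := f '' {l | l ∈ L ∧ l ≠ 0}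
  -- Dickson's lemma.
  have hfin : {p | Minimal (· ∈ S) p}.Finite :=
    WellQuasiOrderedLE.finite_of_isAntichain (setOfPred_minimal_antichain _)
  have hex : ∀ p ∈ {p | Minimal (· ∈ S) p}, ∃ l, (l ∈ L ∧ l ≠ 0) ∧ f l = p :=
    fun p hp => hp.1
  choose! k hk using hex
  refine ⟨hfin.toFinset.image k, ?_, fun l hl hl0 => ?_⟩
  · intro g hg
    obtain ⟨p, hp, rfl⟩ := Finset.mem_image.1 hg
    exact (hk p (hfin.mem_toFinset.1 hp)).1
  · obtain ⟨p, hpl, hp⟩ := exists_minimal_le_of_wellFoundedLT (· ∈ S) (f l) ⟨l, ⟨hl, hl0⟩, rfl⟩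
    refine ⟨k p, Finset.mem_image_of_mem _ (hfin.mem_toFinset.2 hp), hf _ _ ?_⟩
    rw [(hk p hp).2]; exact hpl

/-- Subtracting a move conformally below `w - u` keeps `w` nonnegative and lowers its ℓ¹ distance to
`u`. -/
theorem exists_isMarkovBasis (A : Matrix (Fin m) (Fin n) ℤ) :
    ∃ M : Finset (Fin n → ℤ), IsMarkovBasis A M := by
  obtain ⟨M, hM, hbelow⟩ := exists_finset_conformal_below (kerLattice A)
  refine ⟨M, fun v hv => (hM v hv).1, ?_⟩
  intro w u hw hu
  induction hN : ∑ i, (w i - u i).natAbs using Nat.strong_induction_on generalizing w with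
  | _ N ih =>
    intro hwu
    by_cases h0 : w - u = 0
    · rw [sub_eq_zero.1 h0]
    obtain ⟨g, hg, hp, hn⟩ := hbelow _ hwu h0
    have hcoord : ∀ i, (0 ≤ g i ∧ g i ≤ w i - u i) ∨ (g i ≤ 0 ∧ w i - u i ≤ g i) := by
      intro i
      have h1 : max (g i) 0 ≤ max (w i - u i) 0 := hp i
      have h2 : max (-g i) 0 ≤ max (-(w i - u i)) 0 := hn i
      omega
    have hnonneg : 0 ≤ w - g := by
      intro i
      have h1 := hcoord i
      have h2 : 0 ≤ w i := hw i
      have h3 : 0 ≤ u i := hu i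
      change 0 ≤ w i - g i
      omega
    refine .head ⟨hnonneg, g, hg, Or.inr rfl⟩ (ih _ ?_ _ hnonneg rfl ?_)
    · rw [← hN]
      obtain ⟨i, hi⟩ := Function.ne_iff.1 (hM g hg).2
      refine Finset.sum_lt_sum (fun j _ => ?_) ⟨i, Finset.mem_univ i, ?_⟩
      · have := hcoord j
        rw [Pi.sub_apply]; omega
      · have := hcoord i
        rw [Pi.zero_apply] at hi
        rw [Pi.sub_apply]; omega
    · have := sub_mem hwu (hM g hg).1
      convert this using 1; abel

theorem exists_isMarkovBasis_card_le (A : Matrix (Fin m) (Fin n) ℤ) :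
    ∃ M : Finset (Fin n → ℤ), IsMarkovBasis A M ∧
      ∀ M' : Finset (Fin n → ℤ), IsMarkovBasis A M' → M.card ≤ M'.card := by
  obtain ⟨M₀, hM₀⟩ := exists_isMarkovBasis A
  obtain ⟨M, hM, hmin⟩ := WellFounded.has_min (measure (Finset.card (α := Fin n → ℤ))).wf
    {M | IsMarkovBasis A M} ⟨M₀, hM₀⟩
  exact ⟨M, hM, fun M' hM' => not_lt.1 (hmin M' hM')⟩

theorem mem_universalMarkovBasis_of_card_le (hM : IsMarkovBasis A M)
    (hcard : ∀ M' : Finset (Fin n → ℤ), IsMarkovBasis A M' → M.card ≤ M'.card)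
    {u : Fin n → ℤ} (hu : u ∈ M) : u ∈ universalMarkovBasis A :=
  ⟨M, ⟨hM, fun _ hss h => (hcard _ h).not_gt (Finset.card_lt_card hss)⟩,
    fun M' hM' => hcard M' hM'.1, hu⟩

theorem IsMarkovBasis.erase_zero (hM : IsMarkovBasis A M) : IsMarkovBasis A (M.erase 0) := by
  refine hM.of_forall_move (fun v hv => hM.1 v (Finset.mem_of_mem_erase hv)) fun v hv x _ hxv => ?_
  by_cases h0 : v = 0
  · rw [h0, add_zero]
  · exact markovPath_of_mem (Finset.mem_erase.2 ⟨h0, hv⟩) hxv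

/-- A move may be translated by a multiple of a nonnegative lattice vector that the other moves
reach from the origin. -/
theorem IsMarkovBasis.insert_add_nsmul (hM : IsMarkovBasis A M) {u c : Fin n → ℤ} (hu : u ∈ M)
    (hc : c ∈ kerLattice A) (hpath : Relation.ReflTransGen (MarkovStep (M.erase u)) 0 c) (k : ℕ) :
    IsMarkovBasis A (insert (u + k • c) (M.erase u)) := by
  have hc0 : 0 ≤ c := markovPath_nonneg le_rfl hpath
  have hpath' : Relation.ReflTransGen (MarkovStep (insert (u + k • c) (M.erase u))) 0 c :=
    Relation.ReflTransGen.mono (fun x y ⟨hy, v, hv, h⟩ => ⟨hy, v, Finset.mem_insert_of_mem hv, h⟩)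
      _ _ hpath
  refine hM.of_forall_move (fun v hv => ?_) fun v hv x _ hxv => ?_
  · obtain rfl | hv := Finset.mem_insert.1 hv
    · exact add_mem (hM.1 u hu) (nsmul_mem hc k)
    · exact hM.1 v (Finset.mem_of_mem_erase hv)
  · by_cases h : v = u
    · subst h
      -- Overshoot by the new move, then come back down `k` copies of the path to `c`.
      refine (markovPath_of_mem (Finset.mem_insert_self _ _) ?_).trans ?_
      · rw [← add_assoc]; exact add_nonneg hxv (nsmul_nonneg hc0 k)
      · rw [← add_assoc]
        exact markovPath_symm hxv (markovPath_nsmul hpath' hxv k)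
    · exact markovPath_of_mem (Finset.mem_insert_of_mem (Finset.mem_erase.2 ⟨h, hv⟩)) hxv

theorem exists_add_nsmul_notMem_graverBasis {u c : Fin n → ℤ} (hu : u ∈ kerLattice A)
    (hc : c ∈ kerLattice A) (hc0 : 0 ≤ c) (hne : c ≠ 0) :
    ∃ k : ℕ, u + k • c ∉ graverBasis A := by
  obtain ⟨i₀, hi₀⟩ := Function.ne_iff.1 hne
  have hi₀' : 1 ≤ c i₀ := by
    have : 0 ≤ c i₀ := hc0 i₀
    rw [Pi.zero_apply] at hi₀; omega
  -- `K` exceeds every `|u i|`, so `u + K • c` is positive on the support of `c`. Hence adding one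
  -- more `c` is a conformal sum.
  let K : ℕ := 1 + ∑ i, (u i).natAbs
  have hK : ∀ i, 1 ≤ c i → 1 ≤ (u + K • c) i := by
    intro i hi
    have h1 : (u i).natAbs ≤ ∑ i, (u i).natAbs :=
      Finset.single_le_sum (f := fun i => (u i).natAbs) (fun _ _ => Nat.zero_le _)
        (Finset.mem_univ i)
    have h2 : (K : ℤ) ≤ K * c i := le_mul_of_one_le_right (Int.natCast_nonneg K) hi
    have h3 : (u i).natAbs + 1 ≤ K := by omega
    have h4 : (u + K • c) i = u i + K * c i := by simp
    omega
  refine ⟨K + 1, fun h => h.2.2 ⟨c, u + K • c, hc, add_mem hu (nsmul_mem hc K), hne, ?_, ?_⟩⟩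
  · intro h0
    have := hK i₀ hi₀'
    rw [h0, Pi.zero_apply] at this; omega
  · have hsum : u + (K + 1) • c = c + (u + K • c) := by rw [succ_nsmul]; abel
    have hor : ∀ i, c i = 0 ∨ 1 ≤ c i ∧ 1 ≤ (u + K • c) i := by
      intro i
      have h1 : 0 ≤ c i := hc0 i
      have h2 := hK i
      omega
    rw [hsum]
    refine ⟨rfl, funext fun i => ?_, funext fun i => ?_⟩
    · rw [Pi.add_apply, Pi.posPart_apply, Pi.posPart_apply, Pi.posPart_apply, posPart_def,
        posPart_def, posPart_def, Pi.add_apply]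
      have := hor i
      omega
    · rw [Pi.add_apply, Pi.negPart_apply, Pi.negPart_apply, Pi.negPart_apply, negPart_def,
        negPart_def, negPart_def, Pi.add_apply]
      have := hor i
      omega

/-- A nonnegative lattice vector reached from the origin passes through a move of one sign. -/
theorem exists_signed_move {c : Fin n → ℤ} (hne : c ≠ 0)
    (h : Relation.ReflTransGen (MarkovStep M) 0 c) :
    ∃ v ∈ M, 0 ≤ v ∨ 0 ≤ -v := by
  obtain rfl | ⟨d, ⟨hd, v, hv, rfl | rfl⟩, -⟩ := h.cases_head
  · exact absurd rfl hne
  · exact ⟨v, hv, Or.inl (by simpa using hd)⟩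
  · exact ⟨v, hv, Or.inr (by simpa using hd)⟩

theorem exists_nonneg_span_eq_of_universalMarkovBasis_subset
    (hsub : universalMarkovBasis A ⊆ graverBasis A)
    (hpos : ¬ IsPositiveLattice (kerLattice A)) :
    ∃ c : Fin n → ℤ, 0 ≤ c ∧ c ≠ 0 ∧ kerLattice A = Submodule.span ℤ {c} := by
  obtain ⟨M, hM, hcard⟩ := exists_isMarkovBasis_card_le A
  obtain ⟨d, hd, hd0, hdne⟩ : ∃ d ∈ kerLattice A, 0 ≤ d ∧ d ≠ 0 := by
    by_contra! hcon
    refine hpos (Set.Subset.antisymm (fun d hd => hcon d hd.1 hd.2) ?_)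
    rintro _ rfl
    exact ⟨zero_mem _, le_rfl⟩
  obtain ⟨v, hv, hsign⟩ := exists_signed_move hdne
    (hM.2 0 d le_rfl hd0 (by rw [zero_sub]; exact neg_mem hd))
  have hvne : v ≠ 0 := by
    rintro rfl
    exact (Finset.card_erase_lt_of_mem hv).not_ge (hcard _ hM.erase_zero)
  obtain ⟨c, hc0, hcv⟩ : ∃ c : Fin n → ℤ, 0 ≤ c ∧ (c = v ∨ c = -v) :=
    hsign.elim (fun h => ⟨v, h, Or.inl rfl⟩) fun h => ⟨-v, h, Or.inr rfl⟩
  have hcne : c ≠ 0 := by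
    rcases hcv with rfl | rfl
    · exact hvne
    · exact neg_ne_zero.2 hvne
  have hc : c ∈ kerLattice A := by
    rcases hcv with rfl | rfl
    · exact hM.1 _ hv
    · exact neg_mem (hM.1 _ hv)
  have hsingle : M = {v} := by
    refine Finset.eq_singleton_iff_unique_mem.2 ⟨hv, fun u hu => ?_⟩
    by_contra huv
    have hpath : Relation.ReflTransGen (MarkovStep (M.erase u)) 0 c := by
      refine .single ⟨hc0, v, Finset.mem_erase.2 ⟨Ne.symm huv, hv⟩, ?_⟩
      simpa using hcv
    -- The trade does not increase the cardinality, so the new basis is still smallest, yet it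
    -- contains a non-Graver vector.
    obtain ⟨k, hk⟩ := exists_add_nsmul_notMem_graverBasis (hM.1 u hu) hc hc0 hcne
    refine hk (hsub (mem_universalMarkovBasis_of_card_le (hM.insert_add_nsmul hu hc hpath k)
      (fun M' hM' => le_trans ?_ (hcard M' hM')) (Finset.mem_insert_self _ _)))
    refine (Finset.card_insert_le _ _).trans ?_
    rw [Finset.card_erase_add_one hu]
  refine ⟨c, hc0, hcne, ?_⟩
  rw [← hM.span_eq, hsingle, Finset.coe_singleton]
  rcases hcv with rfl | rfl
  · rfl
  · rw [← Set.neg_singleton, Submodule.span_neg]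

/-! ### Lattices spanned by one nonnegative vector. -/

theorem pureSublattice_eq_and_finrank_eq_one_iff (L : Submodule ℤ (Fin n → ℤ)) :
    (L = pureSublattice L ∧ Module.finrank ℤ L = 1) ↔
      ∃ c : Fin n → ℤ, 0 ≤ c ∧ c ≠ 0 ∧ L = Submodule.span ℤ {c} := by
  constructor
  · rintro ⟨hL, hrank⟩
    obtain ⟨⟨v, hv⟩, hvne, hspan⟩ := finrank_eq_one_iff'.1 hrank
    have hmul : ∀ x ∈ L, ∃ k : ℤ, k • v = x := fun x hx => by
      obtain ⟨k, hk⟩ := hspan ⟨x, hx⟩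
      exact ⟨k, congrArg Subtype.val hk⟩
    have hvne' : v ≠ 0 := fun h => hvne (Subtype.ext h)
    have hLv : L = Submodule.span ℤ {v} :=
      le_antisymm (fun x hx => Submodule.mem_span_singleton.2 (hmul x hx))
        (by rwa [Submodule.span_singleton_le_iff_mem])
    obtain ⟨d, ⟨hd, hd0⟩, hdne⟩ : ∃ d, (d ∈ L ∧ 0 ≤ d) ∧ d ≠ 0 := by
      by_contra! hcon
      have : pureSublattice L = ⊥ := Submodule.span_eq_bot.2 hcon
      rw [this] at hL
      exact hvne' ((Submodule.mem_bot ℤ).1 (hL ▸ hv))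
    obtain ⟨k, rfl⟩ := hmul d hd
    -- The sign of `k` decides which of the generators `± v` is nonnegative.
    rcases lt_trichotomy k 0 with hk | rfl | hk
    · refine ⟨-v, fun i => ?_, neg_ne_zero.2 hvne', ?_⟩
      · have h1 : 0 ≤ k * v i := hd0 i
        change 0 ≤ -v i
        nlinarith
      · rw [← Set.neg_singleton, Submodule.span_neg, hLv]
    · exact absurd (zero_smul ℤ v) hdne
    · refine ⟨v, fun i => ?_, hvne', hLv⟩
      have h1 : 0 ≤ k * v i := hd0 i
      change 0 ≤ v i
      nlinarith
  · rintro ⟨c, hc0, hcne, rfl⟩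
    refine ⟨le_antisymm ?_ (Submodule.span_le.2 fun x hx => hx.1), ?_⟩
    · rw [Submodule.span_singleton_le_iff_mem]
      exact Submodule.subset_span ⟨Submodule.mem_span_singleton_self c, hc0⟩
    · rw [← (LinearEquiv.toSpanNonzeroSingleton ℤ (Fin n → ℤ) c hcne).finrank_eq,
        Module.finrank_self]

theorem isMarkovBasis_singleton {c : Fin n → ℤ} (hc0 : 0 ≤ c)
    (hspan : kerLattice A = Submodule.span ℤ {c}) : IsMarkovBasis A {c} := by
  have hup : ∀ a : Fin n → ℤ, 0 ≤ a → ∀ k : ℕ,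
      Relation.ReflTransGen (MarkovStep {c}) a (a + k • c) := fun a ha k =>
    markovPath_nsmul (.single ⟨hc0, c, Finset.mem_singleton_self c, Or.inl (by simp)⟩) ha k
  refine ⟨fun v hv => ?_, fun w u hw hu hwu => ?_⟩
  · rw [Finset.mem_singleton.1 hv, hspan]
    exact Submodule.mem_span_singleton_self c
  · rw [hspan] at hwu
    obtain ⟨k, hk⟩ := Submodule.mem_span_singleton.1 hwu
    obtain ⟨j, rfl | rfl⟩ := k.eq_nat_or_neg
    · have h := markovPath_symm hu (hup u hu j)
      rwa [← natCast_zsmul, hk, add_sub_cancel] at h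
    · have h := hup w hw j
      rwa [← natCast_zsmul, ← neg_neg ((j : ℤ) • c), ← neg_smul, hk, neg_sub, add_sub_cancel] at h

/-- At a coordinate where `c i > 0`, each nonzero multiple of `c` has absolute value at least `c i`.
Absolute values add in a conformal sum, so two such summands exceed `± c`. -/
theorem mem_graverBasis_of_span_singleton {c x : Fin n → ℤ} (hc0 : 0 ≤ c) (hne : c ≠ 0)
    (hspan : kerLattice A = Submodule.span ℤ {c}) (hx : x = c ∨ x = -c) : x ∈ graverBasis A := by
  have hcmem : c ∈ kerLattice A := hspan ▸ Submodule.mem_span_singleton_self c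
  obtain ⟨i, hi⟩ := Function.ne_iff.1 hne
  have hi' : 0 < c i := lt_of_le_of_ne (hc0 i) (Ne.symm hi)
  refine ⟨?_, ?_, ?_⟩
  · rcases hx with rfl | rfl
    · exact hcmem
    · exact neg_mem hcmem
  · rcases hx with rfl | rfl
    · exact hne
    · exact neg_ne_zero.2 hne
  · rintro ⟨v, w, hv, hw, hv0, hw0, hsum, hp, hn⟩
    rw [hspan] at hv hw
    obtain ⟨a, rfl⟩ := Submodule.mem_span_singleton.1 hv
    obtain ⟨b, rfl⟩ := Submodule.mem_span_singleton.1 hw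
    have ha : a ≠ 0 := by rintro rfl; simp at hv0
    have hb : b ≠ 0 := by rintro rfl; simp at hw0
    have hp' := congrFun hp i
    have hn' := congrFun hn i
    have hs' := congrFun hsum i
    rw [Pi.add_apply, Pi.posPart_apply, Pi.posPart_apply, Pi.posPart_apply, posPart_def,
      posPart_def, posPart_def] at hp'
    rw [Pi.add_apply, Pi.negPart_apply, Pi.negPart_apply, Pi.negPart_apply, negPart_def,
      negPart_def, negPart_def] at hn'
    simp only [Pi.add_apply, Pi.smul_apply, smul_eq_mul] at hp' hn' hs'
    have key : ∀ k : ℤ, k ≠ 0 → c i ≤ k * c i ∨ k * c i ≤ -c i := by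
      intro k hk
      rcases lt_or_gt_of_ne hk with h | h
      · right; nlinarith
      · left; nlinarith
    have h1 := key a ha
    have h2 := key b hb
    rcases hx with rfl | rfl
    · omega
    · rw [Pi.neg_apply] at hp' hn' hs'
      omega

theorem universalMarkovBasis_subset_of_span_singleton {c : Fin n → ℤ} (hc0 : 0 ≤ c) (hne : c ≠ 0)
    (hspan : kerLattice A = Submodule.span ℤ {c}) :
    universalMarkovBasis A ⊆ graverBasis A := by
  have hmin : IsMinimalMarkovBasis A {c} := by
    refine ⟨isMarkovBasis_singleton hc0 hspan, fun M' hM' h => ?_⟩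
    rw [Finset.ssubset_singleton_iff.1 hM'] at h
    have h1 := h.span_eq
    rw [hspan, Finset.coe_empty, Submodule.span_empty] at h1
    exact hne (Submodule.span_singleton_eq_bot.1 h1.symm)
  rintro x ⟨M, ⟨hM, _⟩, hcard, hx⟩
  have hle : M.card ≤ 1 := hcard _ hmin
  have hMx : M = {x} :=
    Finset.eq_singleton_iff_unique_mem.2 ⟨hx, fun y hy => Finset.card_le_one.1 hle y hy x hx⟩
  have hxspan := hM.span_eq
  rw [hMx, Finset.coe_singleton, hspan] at hxspan
  refine mem_graverBasis_of_span_singleton hc0 hne hspan ?_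
  obtain ⟨a, ha⟩ := Submodule.mem_span_singleton.1
    (hxspan ▸ Submodule.mem_span_singleton_self x : x ∈ Submodule.span ℤ {c})
  obtain ⟨b, hb⟩ := Submodule.mem_span_singleton.1
    (hxspan ▸ Submodule.mem_span_singleton_self c : c ∈ Submodule.span ℤ {x})
  have hba : (b * a - 1) • c = 0 := by
    rw [sub_smul, mul_smul, ha, hb, one_smul, sub_self]
  have hba' : b * a = 1 := sub_eq_zero.1 ((smul_eq_zero.1 hba).resolve_right hne)
  rcases Int.isUnit_iff.1 (IsUnit.of_mul_eq_one b (by rw [mul_comm]; exact hba')) with rfl | rfl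
  · left; rw [← ha, one_smul]
  · right; rw [← ha, neg_smul, one_smul]

/-! ### Positive lattices. -/

theorem markovPath_erase_of_conformal (hpos : IsPositiveLattice (kerLattice A))
    (hM : IsMarkovBasis A M) {u v w : Fin n → ℤ} (hv : v ∈ kerLattice A) (hw : w ∈ kerLattice A)
    (hw0 : w ≠ 0) (hsum : IsConformalSum u v w) :
    Relation.ReflTransGen (MarkovStep (M.erase u)) v⁻ v⁺ := by
  obtain ⟨hu, hup, hun⟩ := hsum
  have hzero : ∀ z ∈ kerLattice A, 0 ≤ z → z = 0 := fun z hz hz0 => by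
    have : z ∈ {u : Fin n → ℤ | u ∈ kerLattice A ∧ 0 ≤ u} := ⟨hz, hz0⟩
    rw [hpos] at this
    exact this
  have hdiff : v⁻ - v⁺ ∈ kerLattice A := by
    rw [← neg_sub, posPart_sub_negPart]; exact neg_mem hv
  /- No point of the fibre of `v` is large enough for the move `u` to be applied. -/
  have hfib : ∀ x : Fin n → ℤ, x - v⁻ ∈ kerLattice A → ¬ (0 ≤ x ∧ 0 ≤ x + u) := by
    rintro x hx ⟨hx0, hxu⟩
    have hge : u⁻ ≤ x := fun i => by
      have h1 : 0 ≤ x i := hx0 i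
      have h2 : 0 ≤ x i + u i := hxu i
      rw [Pi.negPart_apply, negPart_def]
      exact sup_le (neg_le_iff_add_nonneg.2 h2) h1
    -- From `x ≥ u⁻ = v⁻ + w⁻`, the lattice vector `x - v⁻` dominates `w⁻ ≥ 0`. Positivity makes it
    -- zero, so `w⁻ = 0`, and positivity again gives `w = 0`.
    have hwn : 0 ≤ w⁻ := negPart_nonneg w
    have h1 : x - v⁻ = 0 := by
      refine hzero _ hx (hwn.trans ?_)
      rw [le_sub_iff_add_le, add_comm, ← hun]
      exact hge
    have h2 : w⁻ = 0 := by
      refine le_antisymm ?_ hwn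
      rw [← h1, le_sub_iff_add_le, add_comm, ← hun]
      exact hge
    refine hw0 (hzero w hw ?_)
    exact negPart_eq_zero.1 h2
  have main : ∀ y, Relation.ReflTransGen (MarkovStep M) v⁻ y →
      y - v⁻ ∈ kerLattice A ∧ Relation.ReflTransGen (MarkovStep (M.erase u)) v⁻ y := by
    intro y hy
    induction hy with
    | refl => exact ⟨by simp, .refl⟩
    | @tail x y h₁ h₂ ih =>
      have hx0 := markovPath_nonneg (negPart_nonneg v) h₁
      obtain ⟨hy0, t, ht, hyt⟩ := h₂
      have hyk : y - v⁻ ∈ kerLattice A := by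
        rcases hyt with rfl | rfl
        · rw [add_sub_right_comm]; exact add_mem ih.1 (hM.1 t ht)
        · rw [sub_right_comm]; exact sub_mem ih.1 (hM.1 t ht)
      refine ⟨hyk, ih.2.tail ⟨hy0, t, Finset.mem_erase.2 ⟨?_, ht⟩, hyt⟩⟩
      rintro rfl
      rcases hyt with rfl | rfl
      · exact hfib _ ih.1 ⟨hx0, hy0⟩
      · exact hfib _ hyk ⟨hy0, by simpa using hx0⟩
  exact (main _ (hM.2 _ _ (negPart_nonneg v) (posPart_nonneg v) hdiff)).2

theorem IsMinimalMarkovBasis.mem_graverBasis (hpos : IsPositiveLattice (kerLattice A))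
    (hM : IsMinimalMarkovBasis A M) {u : Fin n → ℤ} (hu : u ∈ M) : u ∈ graverBasis A := by
  refine ⟨hM.1.1 u hu, ?_, ?_⟩
  · rintro rfl
    exact hM.2 _ (Finset.erase_ssubset hu) hM.1.erase_zero
  rintro ⟨v, w, hv, hw, hv0, hw0, hsum⟩
  have hsum' : IsConformalSum u w v := by
    obtain ⟨h1, h2, h3⟩ := hsum
    exact ⟨by rw [h1, add_comm], by rw [h2, add_comm], by rw [h3, add_comm]⟩
  have hpv := markovPath_erase_of_conformal hpos hM.1 hv hw hw0 hsum
  have hpw := markovPath_erase_of_conformal hpos hM.1 hw hv hv0 hsum'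
  refine hM.2 _ (Finset.erase_ssubset hu) (hM.1.of_forall_move
    (fun t ht => hM.1.1 t (Finset.mem_of_mem_erase ht)) fun t ht x hx hxt => ?_)
  by_cases htu : t = u
  · subst htu
    have hge : 0 ≤ x - t⁻ := fun i => by
      have h1 : 0 ≤ x i := hx i
      have h2 : 0 ≤ x i + t i := hxt i
      rw [Pi.sub_apply, Pi.negPart_apply, negPart_def, Pi.zero_apply, sub_nonneg]
      exact sup_le (neg_le_iff_add_nonneg.2 h2) h1
    -- Write `x` as `v⁻ + w⁻` plus the remainder `x - t⁻`. Turn `v⁻` into `v⁺`, then `w⁻` into `w⁺`,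
    -- carrying the rest along.
    have h1 := markovPath_add_right (add_nonneg (negPart_nonneg w) hge) hpv
    have h2 := markovPath_add_right (add_nonneg (posPart_nonneg v) hge) hpw
    have e1 : v⁻ + (w⁻ + (x - t⁻)) = x := by rw [hsum.2.2]; abel
    have e2 : w⁻ + (v⁺ + (x - t⁻)) = v⁺ + (w⁻ + (x - t⁻)) := by abel
    have e3 : w⁺ + (v⁺ + (x - t⁻)) = x + t := by
      rw [← add_assoc, add_comm w⁺, ← hsum.2.1]
      nth_rw 3 [← posPart_sub_negPart t]
      abel
    rw [e1] at h1
    rw [e2, e3] at h2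
    exact h1.trans h2
  · exact markovPath_of_mem (Finset.mem_erase.2 ⟨htu, ht⟩) hxt

end MarkovBases

theorem mainTheorem1 {m n : ℕ} (A : Matrix (Fin m) (Fin n) ℤ) :
    universalMarkovBasis A ⊆ graverBasis A ↔
      IsPositiveLattice (kerLattice A) ∨
        (kerLattice A = pureSublattice (kerLattice A) ∧
          Module.finrank ℤ (kerLattice A) = 1) := by
  rw [pureSublattice_eq_and_finrank_eq_one_iff]
  constructor
  · intro hsub
    exact or_iff_not_imp_left.2 (exists_nonneg_span_eq_of_universalMarkovBasis_subset hsub)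
  · rintro (hpos | ⟨c, hc0, hne, hspan⟩)
    · rintro u ⟨M, hM, _, hu⟩
      exact hM.mem_graverBasis hpos hu
    · exact universalMarkovBasis_subset_of_span_singleton hc0 hne hspan
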